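/- **Theorem 1.1.** Let $m,n\ge 0$ be integers and let $X=\{x_1,\dots,x_m\}$ and $Y=\{y_1,\dots,y_n\}$ be disjoint sets of letters. *The $H$-triangle.* A shuffle word is a word without repeated letters over $X\uplus Y$ in which $x_i$ appears before $x_j$, and $y_i$ before $y_j$, whenever $i<j$ and both letters occur. Let $\mathsf{Shuf}(m,n)$ be the set of shuffle words. An indel deletes a letter of $X$ from a shuffle word or inserts a letter of $Y$ into it, the result again being a shuffle word; a forward transposition replaces a consecutive subword $x_iy_j$ by $y_jx_i$. The bubble lattice is $\mathsf{Shuf}(m,n)$ ordered by the reflexive and transitive closure of indels and forward transpositions, where $\mathbf u\le\mathbf v$ if $\mathbf v$ is obtained from $\mathbf u$ by such operations; write $\lessdot$ for its covering relation. A right indel $\mathbf u'\hookrightarrow\mathbf u$ is an indel that either deletes from $\mathbf u'$ a letter of $X$ which is the last letter of $\mathbf u'$ or is immediately followed there by a letter of $X$, or inserts a letter of $Y$ which is the last letter of $\mathbf u$ or is immediately followed in $\mathbf u$ by a letter of $Y$. Put $\mathsf{in}(\mathbf u)=|\{\mathbf u' : \mathbf u'\lessdot\mathbf u\}|$, $\mathsf{in}_{\hookrightarrow}(\mathbf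 u)=|\{\mathbf u' : \mathbf u'\hookrightarrow\mathbf u\}|$ and $$H_{m,n}(q,t)=\sum_{\mathbf u\in\mathsf{Shuf}(m,n)}q^{\mathsf{in}(\mathbf u)}\,t^{\mathsf{in}_{\hookrightarrow}(\mathbf u)}.$$ *The $F$-triangle.* Let $x_0,y_0$ be two additional letters. The noncrossing bipartite complex $\Delta(m,n)$ is the abstract simplicial complex whose vertices are the loops, i.e. the elements of $\mathcal L=X\uplus Y$, and the edges, i.e. the elements of $\widetilde{\mathcal E}=\{\{x_s,y_t\} : 0\le s\le m,\ 0\le t\le n,\ (s,t)\ne(0,0)\}$, and whose faces (including the empty one) are the sets $\sigma\subseteq\mathcal L\uplus\widetilde{\mathcal E}$ such that 1. if $\{x,y\}\in\sigma$, then $x\notin\sigma$ and $y\notin\sigma$; 2. if $\{x_{s_1},y_{t_1}\},\{x_{s_2},y_{t_2}\}\in\sigma$ and $s_1<s_2$, then $t_1\le t_2$. Put $$F_{m,n}(q,t)=\sum_{\sigma\in\Delta(m,n)}q^{|\sigma\cap\widetilde{\mathcal E}|}\,t^{|\sigma\cap\mathcal L|}.$$ Then, for all $m,n\ge 0$, the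 identity $$F_{m,n}(q,t)=q^{m+n}\,H_{m,n}\!\left(\frac{q+1}{q},\frac{t+1}{q+1}\right)$$ holds in the field $\mathbb Q(q,t)$ of rational functions. -/

import Mathlib

noncomputable section

namespace BubbleLattice

/-- The letters `X ⊎ Y`: `Sum.inl i` is the letter `x_{i+1}` and `Sum.inr j` is the letter `y_{j+1}`
(the indices in `Fin` start at `0`). -/
abbrev Letter (m n : ℕ) : Type := Fin m ⊕ Fin n

/-- The letter `a` may stand to the left of the letter `b` in a shuffle word: two letters of `X`
(respectively of `Y`) have to occur in strictly increasing order, mixed pairs are unconstrained. -/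
def MayPrecede {m n : ℕ} : Letter m n → Letter m n → Prop
  | Sum.inl i, Sum.inl j => i < j
  | Sum.inr i, Sum.inr j => i < j
  | _, _ => True

/-- Shuffle words: words over `X ⊎ Y` without repeated letters in which the letters of `X` and the
letters of `Y` appear in increasing order. -/
@[ext]
structure ShuffleWord (m n : ℕ) where
  /-- the underlying word -/
  word : List (Letter m n)
  /-- every letter is in the correct order with all later letters; since the order is strict,
  no letter is repeated -/
  ordered : word.Pairwise MayPrecede

lemma ShuffleWord.nodup {m n : ℕ} (u : ShuffleWord m n) : u.word.Nodup :=
  u.ordered.imp (by rintro (a | a) (b | b) h <;> simp_all [MayPrecede] <;> exact h.ne)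

instance (m n : ℕ) : Fintype (ShuffleWord m n) :=
  Fintype.ofInjective
    (fun u => (⟨u.word, u.nodup⟩ : {l : List (Letter m n) // l.Nodup}))
    (fun _ _ h => ShuffleWord.ext (congrArg Subtype.val h))

variable {m n : ℕ}

/-- An indel `u → v`: delete a letter of `X` or insert a letter of `Y`. -/
def Indel (u v : ShuffleWord m n) : Prop :=
  (∃ (a b : List (Letter m n)) (i : Fin m),
    u.word = a ++ Sum.inl i :: b ∧ v.word = a ++ b) ∨
  (∃ (a b : List (Letter m n)) (j : Fin n),
    u.word = a ++ b ∧ v.word = a ++ Sum.inr j :: b)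

/-- A right indel `u ↪ v`: delete a letter of `X` which is the last letter or is followed by a
letter of `X`, or insert a letter of `Y` which becomes the last letter or is followed by a letter
of `Y`. -/
def RightIndel (u v : ShuffleWord m n) : Prop :=
  (∃ (a b : List (Letter m n)) (i : Fin m),
    u.word = a ++ Sum.inl i :: b ∧ v.word = a ++ b ∧
      (b = [] ∨ ∃ (i' : Fin m) (c : List (Letter m n)), b = Sum.inl i' :: c)) ∨
  (∃ (a b : List (Letter m n)) (j : Fin n),
    u.word = a ++ b ∧ v.word = a ++ Sum.inr j :: b ∧
      (b = [] ∨ ∃ (j' : Fin n) (c : List (Letter m n)), b = Sum.inr j' :: c))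

/-- A forward transposition `u ⇒ v`: replace a consecutive subword `xy` by `yx`. -/
def Transposition (u v : ShuffleWord m n) : Prop :=
  ∃ (a b : List (Letter m n)) (i : Fin m) (j : Fin n),
    u.word = a ++ Sum.inl i :: Sum.inr j :: b ∧ v.word = a ++ Sum.inr j :: Sum.inl i :: b

/-- The bubble order: the reflexive and transitive closure of indels and forward transpositions. -/
instance : Preorder (ShuffleWord m n) where
  le := Relation.ReflTransGen (fun u v => Indel u v ∨ Transposition u v)
  le_refl _ := Relation.ReflTransGen.refl
  le_trans _ _ _ := Relation.ReflTransGen.trans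

/-- The in-degree: the number of lower covers in the bubble order. -/
def inDegree (u : ShuffleWord m n) : ℕ := {u' : ShuffleWord m n | u' ⋖ u}.ncard

/-- The indel-degree: the number of right indels ending in `u`. -/
def indelDegree (u : ShuffleWord m n) : ℕ := {u' : ShuffleWord m n | RightIndel u' u}.ncard

/-- The `H`-triangle, a polynomial in `q = X 0` and `t = X 1`. -/
def HTriangle (m n : ℕ) : MvPolynomial (Fin 2) ℤ :=
  ∑ u : ShuffleWord m n, MvPolynomial.X 0 ^ inDegree u * MvPolynomial.X 1 ^ indelDegree u

/-- The edges `{x_s, y_t}` with `0 ≤ s ≤ m`, `0 ≤ t ≤ n` and `(s, t) ≠ (0, 0)`, encoded as the pairs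
`(s, t)`. Here `x_0` and `y_0` are two additional letters. -/
abbrev Edge (m n : ℕ) : Type := {e : Fin (m + 1) × Fin (n + 1) // e ≠ (0, 0)}

/-- The vertices of the noncrossing bipartite complex: the loops (which are the letters in `X ⊎ Y`)
and the edges. -/
abbrev Vertex (m n : ℕ) : Type := Letter m n ⊕ Edge m n

/-- The noncrossing bipartite complex, as a family of finite sets closed under taking subsets (so
that the empty face is included). The letter `x_{i+1} = Sum.inl i` lies on the edge `(s, t)` when
`s = i.succ`, and the letter `y_{j+1} = Sum.inr j` lies on it when `t = j.succ`. -/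
def bipartiteComplex (m n : ℕ) : LowerSet (Finset (Vertex m n)) where
  carrier := {σ |
    (∀ e : Edge m n, Sum.inr e ∈ σ →
      (∀ i : Fin m, e.1.1 = i.succ → Sum.inl (Sum.inl i) ∉ σ) ∧
      (∀ j : Fin n, e.1.2 = j.succ → Sum.inl (Sum.inr j) ∉ σ)) ∧
    (∀ e f : Edge m n, Sum.inr e ∈ σ → Sum.inr f ∈ σ → e.1.1 < f.1.1 → e.1.2 ≤ f.1.2)}
  lower' := fun _ _ hle hσ =>
    ⟨fun e he => ⟨fun i hi h => (hσ.1 e (hle he)).1 i hi (hle h),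
      fun j hj h => (hσ.1 e (hle he)).2 j hj (hle h)⟩,
      fun e f he hf => hσ.2 e f (hle he) (hle hf)⟩

open Classical in
/-- The `F`-triangle, a polynomial in `q = X 0` and `t = X 1`: every face contributes
`q ^ (number of its edges) * t ^ (number of its loops)`. -/
def FTriangle (m n : ℕ) : MvPolynomial (Fin 2) ℤ :=
  ∑ σ : Finset (Vertex m n) with σ ∈ bipartiteComplex m n,
    MvPolynomial.X 0 ^ (σ.filter (fun v => v.isRight)).card *
      MvPolynomial.X 1 ^ (σ.filter (fun v => v.isLeft)).card

/-- The field `ℚ(q, t)` of rational functions in two variables. -/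
abbrev RationalFunctions : Type := FractionRing (MvPolynomial (Fin 2) ℤ)

/-- The variable `q` of `ℚ(q, t)`. -/
def qVar : RationalFunctions :=
  algebraMap (MvPolynomial (Fin 2) ℤ) RationalFunctions (MvPolynomial.X 0)

/-- The variable `t` of `ℚ(q, t)`. -/
def tVar : RationalFunctions :=
  algebraMap (MvPolynomial (Fin 2) ℤ) RationalFunctions (MvPolynomial.X 1)

/-- The value `P(a, b)` of a polynomial `P` in two variables at rational functions `a`, `b`. -/
def evalAt (P : MvPolynomial (Fin 2) ℤ) (a b : RationalFunctions) : RationalFunctions :=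
  MvPolynomial.aeval ![a, b] P

end BubbleLattice

end

open BubbleLattice

/-! Both sides satisfy one linear recurrence. With `s = q + 1 + t` it reads `P (m+1) (n+1) = s * P m
(n+1) + s * P (m+1) n + (q * (q+1) - s^2) * P m n`, together with `P 0 0 = 1` and a factor `s` for
each step along either axis.

Faces are the sets of vertices without a conflicting pair, so `F` is an independence polynomial and
can be computed by removing vertices one at a time. Removing the loop at the last letter of `X` and
then the edges at that letter, sorted by their smallest `Y`-end, gives a convolution sum
(`faceSum_succ`). Subtracting `s` times its value at `n` from that at `n + 1` leaves the recurrence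
(`faceSum_succ_succ`).

For `H`, the covers are exactly the right indels and the forward transpositions (`covBy_iff`). Let a
word have `a` letters of `X`, `b` letters of `Y` and `d` consecutive subwords `yx`. Transpositions
into it correspond to these subwords. Right indels into it correspond to the `m - a` missing letters
of `X`, each with a unique admissible place, and to the `b - d` letters of `Y` not followed by one
of `X`. Hence `in = m - a + b` and the indel-degree is `m - a + b - d`. The substitution therefore
turns a word's term into the product `q^(a+n-b) * (q+1)^d * (1+t)^(m-a+b-d)` (`wordWeight_eq`).
Splitting words by their first letter gives the same recurrence (`wordSum_succ_succ`). -/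

namespace BubbleLattice

/-! ### Independence polynomials of a conflict relation -/

section IndependenceSum

open Classical in
/-- The generating function of the subsets of `S` without conflicting pairs. -/
noncomputable def indepSum {V R : Type*} [CommRing R] (C : V → V → Prop) (w : V → R)
    (S : Finset V) : R :=
  ∑ σ ∈ S.powerset with (∀ a ∈ σ, ∀ b ∈ σ, ¬ C a b), ∏ v ∈ σ, w v

variable {V R : Type*} [CommRing R] {C : V → V → Prop} {w : V → R}

lemma indepSum_empty : indepSum C w ∅ = 1 := by
  classical
  simp [indepSum, Finset.sum_filter]

-- Deletion and link: an independent set either avoids `v`, or is `v` together with an independent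
-- set of vertices compatible with `v`.
open Classical in
lemma indepSum_insert [DecidableEq V] (hs : ∀ a b, C a b → C b a) (hi : ∀ a, ¬ C a a) {v : V}
    {S : Finset V} (hv : v ∉ S) :
    indepSum C w (insert v S) = indepSum C w S + w v * indepSum C w {a ∈ S | ¬ C v a} := by
  simp only [indepSum, Finset.sum_filter]
  rw [Finset.sum_powerset_insert hv]
  congr 1
  rw [Finset.mul_sum]
  refine (Finset.sum_subset_zero_on_sdiff (Finset.powerset_mono.2 (Finset.filter_subset _ _))
    (fun σ h => if_neg fun hc => ?_) (fun σ h => ?_)).symm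
  · refine (Finset.mem_sdiff.1 h).2 (Finset.mem_powerset.2 fun a ha => Finset.mem_filter.2 ⟨?_, ?_⟩)
    · exact Finset.mem_powerset.1 (Finset.mem_sdiff.1 h).1 ha
    · exact hc v (Finset.mem_insert_self _ _) a (Finset.mem_insert_of_mem ha)
  · have h' : ∀ a ∈ σ, a ∈ S ∧ ¬ C v a := fun a ha =>
      Finset.mem_filter.1 (Finset.mem_powerset.1 h ha)
    rw [Finset.prod_insert fun hm => hv (h' v hm).1, mul_ite, mul_zero]
    have hiff : (∀ a ∈ insert v σ, ∀ b ∈ insert v σ, ¬ C a b) ↔ ∀ a ∈ σ, ∀ b ∈ σ, ¬ C a b := by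
      refine ⟨fun hc a ha b hb => ?_, fun hc a ha b hb => ?_⟩
      · exact hc a (Finset.mem_insert_of_mem ha) b (Finset.mem_insert_of_mem hb)
      · rw [Finset.mem_insert] at ha hb
        rcases ha with rfl | ha <;> rcases hb with rfl | hb
        · exact hi _
        · exact (h' b hb).2
        · exact fun hab => (h' a ha).2 (hs _ _ hab)
        · exact hc a ha b hb
    simp only [hiff]
    split_ifs <;> rfl

-- Two vertices in conflict only with each other split off a factor: neither, the first, or the
-- second is chosen.
open Classical in
lemma indepSum_insert_pair [DecidableEq V] (hs : ∀ a b, C a b → C b a) (hi : ∀ a, ¬ C a a)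
    {a b : V} {S : Finset V} (ha : a ∉ S) (hb : b ∉ S) (hab : C a b) (hne : ∀ v ∈ S, ¬ C a v ∧ ¬ C b v) :
    indepSum C w (insert a (insert b S)) = (1 + w a + w b) * indepSum C w S := by
  have hab' : a ≠ b := fun h => hi a (by rwa [← h] at hab)
  rw [indepSum_insert hs hi (by simp [ha, hab']), indepSum_insert hs hi hb, Finset.filter_insert,
    if_neg (by simpa using hab), Finset.filter_true_of_mem fun v hv => (hne v hv).1,
    Finset.filter_true_of_mem fun v hv => (hne v hv).2]
  ring

lemma indepSum_map {V' : Type*} (f : V' ↪ V) (S : Finset V') :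
    indepSum C w (S.map f) = indepSum (fun a b => C (f a) (f b)) (w ∘ f) S := by
  classical
  unfold indepSum
  symm
  refine Finset.sum_bij (fun σ _ => σ.map f) ?_ ?_ ?_ ?_
  · intro σ h
    simp only [Finset.mem_filter, Finset.mem_powerset] at h ⊢
    refine ⟨Finset.map_subset_map.2 h.1, ?_⟩
    simpa using h.2
  · intro σ _ τ _ h
    exact Finset.map_injective f h
  · intro σ h
    simp only [Finset.mem_filter, Finset.mem_powerset] at h
    obtain ⟨τ, hτ, rfl⟩ := Finset.subset_map_iff.1 h.1
    refine ⟨τ, ?_, rfl⟩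
    simp only [Finset.mem_filter, Finset.mem_powerset]
    exact ⟨hτ, by simpa using h.2⟩
  · intro σ _
    simp

end IndependenceSum

/-! ### The complex inside a common vertex set, independent of `m` and `n` -/

/-- Loops `x_i`, `y_j` and edges `{x_s, y_t}` with arbitrary natural indices. -/
abbrev NatVertex : Type := (ℕ ⊕ ℕ) ⊕ (ℕ × ℕ)

/-- Two vertices which never lie in a common face of a noncrossing bipartite complex. -/
def Conflict : NatVertex → NatVertex → Prop
  | Sum.inl (Sum.inl i), Sum.inr e => e.1 = i
  | Sum.inl (Sum.inr j), Sum.inr e => e.2 = j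
  | Sum.inr e, Sum.inl (Sum.inl i) => e.1 = i
  | Sum.inr e, Sum.inl (Sum.inr j) => e.2 = j
  | Sum.inr e, Sum.inr f => (e.1 < f.1 ∧ f.2 < e.2) ∨ (f.1 < e.1 ∧ e.2 < f.2)
  | Sum.inl _, Sum.inl _ => False

lemma Conflict.symm : ∀ a b : NatVertex, Conflict a b → Conflict b a := by
  rintro ((i | j) | e) ((i' | j') | f) <;> simp only [Conflict] <;> tauto

lemma Conflict.irrefl : ∀ a : NatVertex, ¬ Conflict a a := by
  rintro ((i | j) | e) <;> simp [Conflict]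

/-- Edges have weight `q` and loops have weight `t`. -/
def vertexWeight {R : Type*} (q t : R) : NatVertex → R := Sum.elim (fun _ => t) (fun _ => q)

/-- The vertices of the complex with parameters `m` and `n`. -/
def natVertices (m n : ℕ) : Finset NatVertex :=
  ((Finset.Icc 1 m).disjSum (Finset.Icc 1 n)).disjSum
    ((Finset.range (m + 1) ×ˢ Finset.range (n + 1)).erase (0, 0))

/-- The edges `{x_s, y_t}` with `k ≤ t ≤ n`. -/
def fanEdges (s k n : ℕ) : Finset NatVertex :=
  (∅ : Finset (ℕ ⊕ ℕ)).disjSum ({s} ×ˢ Finset.Icc k n)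

/-- The loops `y_j` with `k ≤ j ≤ n`. -/
def upperLoops (k n : ℕ) : Finset NatVertex :=
  ((∅ : Finset ℕ).disjSum (Finset.Icc k n)).disjSum ∅

/-! ### Recurrence for the face generating function -/

section FaceSum

variable {R : Type*} [CommRing R] (q t : R)

/-- The face generating function of the complex with parameters `m` and `n`. -/
noncomputable def faceSum (m n : ℕ) : R := indepSum Conflict (vertexWeight q t) (natVertices m n)

/-- The face generating function without the loop `y_n`. -/
noncomputable def faceSumNoLoop (m n : ℕ) : R :=
  indepSum Conflict (vertexWeight q t) ((natVertices m n).erase (Sum.inl (Sum.inr n)))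

lemma faceSum_zero_zero : faceSum q t 0 0 = 1 := by
  have : natVertices 0 0 = ∅ := by decide
  rw [faceSum, this, indepSum_empty]

lemma faceSum_zero_succ (n : ℕ) : faceSum q t 0 (n + 1) = (q + 1 + t) * faceSum q t 0 n := by
  have h : natVertices 0 (n + 1) =
      insert (Sum.inl (Sum.inr (n + 1))) (insert (Sum.inr (0, n + 1)) (natVertices 0 n)) := by
    ext ((i | j) | ⟨s, k⟩) <;> simp [natVertices] <;> omega
  rw [faceSum, h, indepSum_insert_pair Conflict.symm Conflict.irrefl]
  · simp only [vertexWeight, Sum.elim_inl, Sum.elim_inr, faceSum]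
    ring
  · simp [natVertices]
  · simp [natVertices]
  · simp [Conflict]
  · rintro ((i | j) | ⟨s, k⟩) <;> simp [natVertices, Conflict] <;> omega

/-- The loop `y_{n+1}` excludes exactly the edges at `y_{n+1}`; what remains is the vertex set for
`m` and `n`. -/
lemma faceSum_eq_noLoop (m n : ℕ) :
    faceSum q t m (n + 1) = faceSumNoLoop q t m (n + 1) + t * faceSum q t m n := by
  classical
  rw [faceSum, ← Finset.insert_erase (s := natVertices m (n + 1)) (a := Sum.inl (Sum.inr (n + 1)))
    (by simp [natVertices]), indepSum_insert Conflict.symm Conflict.irrefl (by simp)]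
  congr 2
  rw [faceSum]
  congr 1
  ext ((i | j) | ⟨s, k⟩) <;> rw [Finset.mem_filter] <;>
    simp [natVertices, Conflict] <;> omega

lemma faceSumNoLoop_zero (m : ℕ) : faceSumNoLoop q t m 0 = faceSum q t m 0 := by
  rw [faceSum, faceSumNoLoop, Finset.erase_eq_of_notMem (by simp [natVertices])]

/-- For `j > k` the loop `y_j` and the edge `{x_{m+1}, y_j}` conflict only with each other, because
the remaining edges at lower letters of `X` end at or below `y_k`. Each such pair gives a factor `q
+ 1 + t`. -/
lemma indepSum_noLoop_union (m k d : ℕ) :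
    indepSum Conflict (vertexWeight q t) ((natVertices m k).erase (Sum.inl (Sum.inr k)) ∪
      (upperLoops (k + 1) (k + d) ∪ fanEdges (m + 1) (k + 1) (k + d))) =
    (q + 1 + t) ^ d * faceSumNoLoop q t m k := by
  induction d with
  | zero => simp [upperLoops, fanEdges, faceSumNoLoop]
  | succ d ih =>
    rw [pow_succ', mul_assoc, ← ih]
    set S := (natVertices m k).erase (Sum.inl (Sum.inr k)) ∪
      (upperLoops (k + 1) (k + d) ∪ fanEdges (m + 1) (k + 1) (k + d)) with hS
    have h : (natVertices m k).erase (Sum.inl (Sum.inr k)) ∪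
        (upperLoops (k + 1) (k + (d + 1)) ∪ fanEdges (m + 1) (k + 1) (k + (d + 1))) =
        insert (Sum.inl (Sum.inr (k + d + 1))) (insert (Sum.inr (m + 1, k + d + 1)) S) := by
      ext ((i | j) | ⟨s, l⟩) <;> simp [natVertices, upperLoops, fanEdges, hS] <;> omega
    rw [h, indepSum_insert_pair Conflict.symm Conflict.irrefl]
    · simp only [vertexWeight, Sum.elim_inl, Sum.elim_inr]
      ring
    · simp [natVertices, upperLoops, fanEdges, hS]
    · simp [natVertices, upperLoops, fanEdges, hS]
    · simp [Conflict]
    · rintro ((i | j) | ⟨s, l⟩) <;>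
        simp [natVertices, upperLoops, fanEdges, hS, Conflict] <;> omega

/-- Faces are sorted by the smallest `l` for which they contain the edge `{x_{m+1}, y_l}`; the first
summand counts those with no such edge. -/
lemma indepSum_fanEdges (m n k d : ℕ) (hk : k + d = n + 1) :
    indepSum Conflict (vertexWeight q t) (natVertices m n ∪ fanEdges (m + 1) k n) =
      faceSum q t m n +
        ∑ l ∈ Finset.Ico k (n + 1), q * ((q + 1 + t) ^ (n - l) * faceSumNoLoop q t m l) := by
  classical
  induction d generalizing k with
  | zero =>
    obtain rfl : k = n + 1 := by omega
    simp [fanEdges, faceSum]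
  | succ d ih =>
    rw [Finset.sum_eq_sum_Ico_succ_bot (by omega), add_left_comm, ← ih (k + 1) (by omega)]
    have h : natVertices m n ∪ fanEdges (m + 1) k n =
        insert (Sum.inr (m + 1, k)) (natVertices m n ∪ fanEdges (m + 1) (k + 1) n) := by
      ext ((i | j) | ⟨s, l⟩) <;> simp [natVertices, fanEdges]; omega
    rw [h, indepSum_insert Conflict.symm Conflict.irrefl (by simp [natVertices, fanEdges]),
      add_comm]
    congr 1
    -- The edge `{x_{m+1}, y_k}` excludes the loop `y_k` and all edges from lower letters of `X` to
    -- some `y_l` with `l > k`. The loops `y_j` with `j > k` survive.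
    rw [← indepSum_noLoop_union]
    simp only [vertexWeight, Sum.elim_inr]
    congr 2
    ext ((i | j) | ⟨s, l⟩) <;>
      simp [natVertices, fanEdges, upperLoops, Conflict] <;> omega

/-- The loop `x_{m+1}` excludes all edges at `x_{m+1}`, which gives the summand `t * faceSum q t m
n`; faces without this loop are counted by `indepSum_fanEdges`. -/
lemma faceSum_succ (m n : ℕ) : faceSum q t (m + 1) n = (1 + t) * faceSum q t m n +
    ∑ l ∈ Finset.range (n + 1), q * ((q + 1 + t) ^ (n - l) * faceSumNoLoop q t m l) := by
  classical
  have h : natVertices (m + 1) n =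
      insert (Sum.inl (Sum.inl (m + 1))) (natVertices m n ∪ fanEdges (m + 1) 0 n) := by
    ext ((i | j) | ⟨s, l⟩) <;> simp [natVertices, fanEdges] <;> omega
  rw [faceSum, h, indepSum_insert Conflict.symm Conflict.irrefl
    (by simp [natVertices, fanEdges]), indepSum_fanEdges q t m n 0 (n + 1) (by omega),
    Finset.range_eq_Ico, add_mul, one_mul, add_right_comm]
  congr 1
  rw [faceSum]
  simp only [vertexWeight, Sum.elim_inl]
  congr 3
  ext ((i | j) | ⟨s, l⟩) <;> simp [natVertices, fanEdges, Conflict]; omega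

lemma faceSum_succ_zero (m : ℕ) : faceSum q t (m + 1) 0 = (q + 1 + t) * faceSum q t m 0 := by
  rw [faceSum_succ]
  simp [faceSumNoLoop_zero]
  ring

/-- Passing from `n` to `n + 1` multiplies every old summand of `faceSum_succ` by `q + 1 + t` and
adds the summand `l = n + 1`. The old sum and the loop-free term are then eliminated by
`faceSum_succ` and `faceSum_eq_noLoop`. -/
lemma faceSum_succ_succ (m n : ℕ) : faceSum q t (m + 1) (n + 1) =
    (q + 1 + t) * faceSum q t m (n + 1) + (q + 1 + t) * faceSum q t (m + 1) n +
      (q * (q + 1) - (q + 1 + t) ^ 2) * faceSum q t m n := by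
  have h : ∑ l ∈ Finset.range (n + 1),
      q * ((q + 1 + t) ^ (n + 1 - l) * faceSumNoLoop q t m l) =
      (q + 1 + t) * ∑ l ∈ Finset.range (n + 1),
        q * ((q + 1 + t) ^ (n - l) * faceSumNoLoop q t m l) := by
    rw [Finset.mul_sum]
    refine Finset.sum_congr rfl fun l hl => ?_
    rw [Nat.succ_sub (Nat.lt_succ_iff.1 (Finset.mem_range.1 hl)), pow_succ]
    ring
  rw [faceSum_succ q t m (n + 1), Finset.sum_range_succ, h,
    ← sub_eq_iff_eq_add'.2 (faceSum_succ q t m n),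
    ← sub_eq_iff_eq_add.2 (faceSum_eq_noLoop q t m n)]
  simp
  ring

end FaceSum

/-! ### Identification of `FTriangle` with `faceSum` -/

/-- The vertices of the complex, with natural indices. -/
def natVertex (m n : ℕ) : Vertex m n ↪ NatVertex where
  toFun := Sum.map (Sum.map (fun i => i.val + 1) (fun j => j.val + 1))
    (fun e => (e.1.1.val, e.1.2.val))
  inj' := by
    rintro ((i | j) | ⟨⟨s, k⟩, h⟩) ((i' | j') | ⟨⟨s', k'⟩, h'⟩) <;> simp [Fin.ext_iff]

@[simp]
lemma natVertex_loopX {m n : ℕ} (i : Fin m) :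
    natVertex m n (Sum.inl (Sum.inl i)) = Sum.inl (Sum.inl (i.val + 1)) := rfl

@[simp]
lemma natVertex_loopY {m n : ℕ} (j : Fin n) :
    natVertex m n (Sum.inl (Sum.inr j)) = Sum.inl (Sum.inr (j.val + 1)) := rfl

@[simp]
lemma natVertex_edge {m n : ℕ} (e : Edge m n) :
    natVertex m n (Sum.inr e) = Sum.inr (e.1.1.val, e.1.2.val) := rfl

lemma map_natVertex_univ (m n : ℕ) : Finset.univ.map (natVertex m n) = natVertices m n := by
  ext v
  simp only [Finset.mem_map, Finset.mem_univ, true_and]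
  constructor
  · rintro ⟨((i | j) | ⟨⟨s, k⟩, h⟩), rfl⟩
    · simp [natVertices]
    · simp [natVertices]
    · simp only [ne_eq, Prod.mk.injEq, Fin.ext_iff] at h
      simpa [natVertices, Nat.lt_succ_iff, s.is_le, k.is_le] using h
  · rcases v with ((i | j) | ⟨s, k⟩)
    · intro h
      have h : 1 ≤ i ∧ i ≤ m := by simpa [natVertices] using h
      exact ⟨Sum.inl (Sum.inl ⟨i - 1, by omega⟩), by simp ; omega⟩
    · intro h
      have h : 1 ≤ j ∧ j ≤ n := by simpa [natVertices] using h
      exact ⟨Sum.inl (Sum.inr ⟨j - 1, by omega⟩), by simp ; omega⟩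
    · intro h
      simp [natVertices] at h
      exact ⟨Sum.inr ⟨(⟨s, by omega⟩, ⟨k, by omega⟩), by simpa [Fin.ext_iff] using h.1⟩,
        by simp ⟩

lemma mem_bipartiteComplex_iff {m n : ℕ} (σ : Finset (Vertex m n)) :
    σ ∈ bipartiteComplex m n ↔
      ∀ a ∈ σ, ∀ b ∈ σ, ¬ Conflict (natVertex m n a) (natVertex m n b) := by
  constructor
  · rintro ⟨h1, h2⟩ ((i | j) | e) ha ((i' | j') | f) hb <;> simp [Conflict]
    · exact fun h => (h1 f hb).1 i (Fin.ext (by simpa using h)) ha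
    · exact fun h => (h1 f hb).2 j (Fin.ext (by simpa using h)) ha
    · exact fun h => (h1 e ha).1 i' (Fin.ext (by simpa using h)) hb
    · exact fun h => (h1 e ha).2 j' (Fin.ext (by simpa using h)) hb
    · exact ⟨h2 e f ha hb, h2 f e hb ha⟩
  · intro h
    refine ⟨fun e he => ⟨fun i hi hm => h _ he _ hm ?_, fun j hj hm => h _ he _ hm ?_⟩,
      fun e f he hf hlt => ?_⟩
    · simp [Conflict, hi]
    · simp [Conflict, hj]
    · by_contra hc
      exact h _ he _ hf (Or.inl ⟨hlt, not_le.1 hc⟩)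

lemma evalAt_FTriangle (m n : ℕ) (a b : RationalFunctions) :
    evalAt (FTriangle m n) a b = faceSum a b m n := by
  classical
  rw [faceSum, ← map_natVertex_univ, indepSum_map, indepSum, evalAt, FTriangle, map_sum]
  refine Finset.sum_congr ?_ fun σ _ => ?_
  · ext σ
    simp [mem_bipartiteComplex_iff]
  · simp only [map_mul, map_pow, MvPolynomial.aeval_X, Matrix.cons_val_zero, Matrix.cons_val_one]
    rw [← Finset.prod_filter_mul_prod_filter_not σ (fun v => v.isRight)]
    congr 1
    · rw [Finset.prod_congr rfl (g := fun _ => a), Finset.prod_const]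
      rintro ((v | v) | v) hv <;> simp [vertexWeight] at hv ⊢
    · rw [Finset.prod_congr rfl (g := fun _ => b), Finset.prod_const]
      · congr 3
        ext v
        simp
      · rintro ((v | v) | v) hv <;> simp [vertexWeight] at hv ⊢

/-! ### Inversions and the cover relations of the bubble order -/

section Inversions

variable {m n : ℕ}

/-- The letter `y_j` does not appear before `x_i` in the word `l`. -/
def NoInversion (l : List (Letter m n)) (i : Fin m) (j : Fin n) : Prop :=
  l.Pairwise fun p r => ¬ (p = Sum.inr j ∧ r = Sum.inl i)

@[simp]
lemma noInversion_nil (i : Fin m) (j : Fin n) : NoInversion ([] : List (Letter m n)) i j :=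
  List.Pairwise.nil

@[simp]
lemma noInversion_cons (p : Letter m n) (l : List (Letter m n)) (i : Fin m) (j : Fin n) :
    NoInversion (p :: l) i j ↔ ¬ (p = Sum.inr j ∧ Sum.inl i ∈ l) ∧ NoInversion l i j := by
  simp only [NoInversion, List.pairwise_cons]
  grind

@[simp]
lemma noInversion_append (a b : List (Letter m n)) (i : Fin m) (j : Fin n) :
    NoInversion (a ++ b) i j ↔
      NoInversion a i j ∧ NoInversion b i j ∧ ¬ (Sum.inr j ∈ a ∧ Sum.inl i ∈ b) := by
  simp only [NoInversion, List.pairwise_append]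
  grind

lemma noInversion_of_notMem_left {l : List (Letter m n)} {i : Fin m} (h : Sum.inl i ∉ l)
    (j : Fin n) : NoInversion l i j := by
  induction l with
  | nil => simp
  | cons p l ih => simp_all

lemma noInversion_of_notMem_right {l : List (Letter m n)} {j : Fin n} (h : Sum.inr j ∉ l)
    (i : Fin m) : NoInversion l i j := by
  induction l with
  | nil => simp
  | cons p l ih =>
    simp only [List.mem_cons, not_or] at h
    simp [ih h.2, Ne.symm h.1]

/-- If `x_i` occurs, it stands before `x_{i'}`, so a `y_j` before `x_i` would also be before
`x_{i'}`. -/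
lemma NoInversion.of_lt_left {l : List (Letter m n)} (hl : l.Pairwise MayPrecede) {i i' : Fin m}
    {j : Fin n} (hi : i < i') (hm : Sum.inl i' ∈ l) (h : NoInversion l i' j) :
    NoInversion l i j := by
  induction l with
  | nil => simp
  | cons p l ih =>
    rw [List.pairwise_cons] at hl
    rw [noInversion_cons] at h ⊢
    rcases List.mem_cons.1 hm with rfl | hm'
    · refine ⟨by simp, noInversion_of_notMem_left (fun hc => ?_) j⟩
      exact lt_asymm hi (hl.1 _ hc)
    · exact ⟨fun hc => h.1 ⟨hc.1, hm'⟩, ih hl.2 hm' h.2⟩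

lemma NoInversion.of_lt_right {l : List (Letter m n)} (hl : l.Pairwise MayPrecede) {i : Fin m}
    {j j' : Fin n} (hj : j < j') (hm : Sum.inr j ∈ l) (h : NoInversion l i j) :
    NoInversion l i j' := by
  induction l with
  | nil => simp
  | cons p l ih =>
    rw [List.pairwise_cons] at hl
    rw [noInversion_cons] at h ⊢
    rcases List.mem_cons.1 hm with rfl | hm'
    · have : Sum.inl i ∉ l := fun hc => h.1 ⟨rfl, hc⟩
      exact ⟨fun hc => this hc.2, noInversion_of_notMem_left this _⟩
    · refine ⟨?_, ih hl.2 hm' h.2⟩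
      rintro ⟨rfl, -⟩
      exact lt_asymm hj (hl.1 _ hm')

lemma noInversion_of_sublist {l : List (Letter m n)} (hl : l.Nodup) {i : Fin m} {j : Fin n}
    (h : [Sum.inl i, Sum.inr j].Sublist l) : NoInversion l i j := by
  induction l with
  | nil => simp
  | cons p l ih =>
    rw [List.nodup_cons] at hl
    rw [noInversion_cons]
    rcases List.sublist_cons_iff.1 h with h' | ⟨r, hr, h'⟩
    · refine ⟨?_, ih hl.2 h'⟩
      rintro ⟨rfl, -⟩
      exact hl.1 (h'.subset (List.mem_cons_of_mem _ List.mem_cons_self))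
    · simp only [List.cons.injEq] at hr
      obtain ⟨rfl, rfl⟩ := hr
      exact ⟨by simp, noInversion_of_notMem_left hl.1 j⟩

/-- The relative order of two letters, as prescribed by the inversions of `u`. -/
def InversionOrder (u : List (Letter m n)) : Letter m n → Letter m n → Prop
  | Sum.inl i, Sum.inl i' => i < i'
  | Sum.inr j, Sum.inr j' => j < j'
  | Sum.inl i, Sum.inr j => NoInversion u i j
  | Sum.inr j, Sum.inl i => ¬ NoInversion u i j

lemma pairwise_inversionOrder {u : List (Letter m n)} {v : ShuffleWord m n}
    (h : ∀ i j, NoInversion u i j ↔ NoInversion v.word i j) :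
    v.word.Pairwise (InversionOrder u) := by
  rw [List.pairwise_iff_forall_sublist]
  rintro (i | j) (i' | j') hs
  · simpa [MayPrecede, InversionOrder] using v.ordered.sublist hs
  · exact (h i j').2 (noInversion_of_sublist v.nodup hs)
  · exact fun hc => by simpa using List.Pairwise.sublist hs ((h i' j).1 hc)
  · simpa [MayPrecede, InversionOrder] using v.ordered.sublist hs

/-- The inversions decide every mixed pair and the indices every other pair, so both words sort the
same letters by the same antisymmetric relation. -/
lemma ShuffleWord.eq_of_noInversion_iff {u v : ShuffleWord m n}
    (hmem : ∀ l, l ∈ u.word ↔ l ∈ v.word)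
    (h : ∀ i j, NoInversion u.word i j ↔ NoInversion v.word i j) : u = v := by
  refine ShuffleWord.ext (List.Perm.eq_of_pairwise (le := InversionOrder u.word) ?_
    (pairwise_inversionOrder fun _ _ => Iff.rfl) (pairwise_inversionOrder h)
    ((List.perm_ext_iff_of_nodup u.nodup v.nodup).2 hmem))
  rintro (i | j) (i' | j') - - h1 h2
  · exact absurd h1 (lt_asymm h2)
  · exact absurd h1 h2
  · exact absurd h2 h1
  · exact absurd h1 (lt_asymm h2)

/-- The letters of `X` decrease, the letters of `Y` increase, and inversions persist. -/
structure ShuffleWord.Below (u v : ShuffleWord m n) : Prop where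
  left : ∀ i, Sum.inl i ∈ v.word → Sum.inl i ∈ u.word
  right : ∀ j, Sum.inr j ∈ u.word → Sum.inr j ∈ v.word
  inversion : ∀ i j, Sum.inl i ∈ v.word → NoInversion v.word i j → NoInversion u.word i j

lemma ShuffleWord.Below.trans {u v w : ShuffleWord m n} (h1 : u.Below v) (h2 : v.Below w) :
    u.Below w where
  left i hi := h1.left i (h2.left i hi)
  right j hj := h2.right j (h1.right j hj)
  inversion i j hi h := h1.inversion i j (h2.left i hi) (h2.inversion i j hi h)

lemma Indel.below {u v : ShuffleWord m n} (h : Indel u v) : u.Below v := by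
  rcases h with ⟨a, b, i, hu, hv⟩ | ⟨a, b, j, hu, hv⟩
  · have hn := u.nodup
    rw [hu, List.nodup_middle, List.nodup_cons] at hn
    refine ⟨fun k hk => ?_, fun k hk => ?_, fun k l hk h => ?_⟩ <;> rw [hu, hv] at * <;>
      simp at * <;> grind
  · refine ⟨fun k hk => ?_, fun k hk => ?_, fun k l hk h => ?_⟩ <;> rw [hu, hv] at * <;>
      simp at * <;> grind

lemma Transposition.below {u v : ShuffleWord m n} (h : Transposition u v) : u.Below v := by
  obtain ⟨a, b, i, j, hu, hv⟩ := h
  refine ⟨fun k hk => ?_, fun k hk => ?_, fun k l hk h => ?_⟩ <;> rw [hu, hv] at * <;>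
      simp at * <;> grind

/-- `Below` is only a necessary condition for the order, but it is antisymmetric and confines every
intermediate word, which suffices to recognise covers. -/
lemma ShuffleWord.below_of_le {u v : ShuffleWord m n} (h : u ≤ v) : u.Below v := by
  induction h with
  | refl => exact ⟨fun _ => id, fun _ => id, fun _ _ _ => id⟩
  | tail _ h ih => exact ih.trans (h.elim Indel.below Transposition.below)

lemma ShuffleWord.eq_of_below {u v : ShuffleWord m n} (h1 : u.Below v) (h2 : v.Below u) :
    u = v := by
  have hl : ∀ i, Sum.inl i ∈ u.word ↔ Sum.inl i ∈ v.word := fun i => ⟨h2.left i, h1.left i⟩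
  refine ShuffleWord.eq_of_noInversion_iff ?_ fun i j => ?_
  · rintro (i | j)
    · exact hl i
    · exact ⟨h1.right j, h2.right j⟩
  · by_cases hi : Sum.inl i ∈ u.word
    · exact ⟨h2.inversion i j hi, h1.inversion i j ((hl i).1 hi)⟩
    · exact iff_of_true (noInversion_of_notMem_left hi j)
        (noInversion_of_notMem_left (fun h => hi ((hl i).2 h)) j)

lemma Indel.le {u v : ShuffleWord m n} (h : Indel u v) : u ≤ v :=
  Relation.ReflTransGen.single (Or.inl h)

lemma Transposition.le {u v : ShuffleWord m n} (h : Transposition u v) : u ≤ v :=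
  Relation.ReflTransGen.single (Or.inr h)

lemma Indel.ne {u v : ShuffleWord m n} (h : Indel u v) : u ≠ v := by
  rintro rfl
  rcases h with ⟨a, b, i, h, h'⟩ | ⟨a, b, i, h, h'⟩ <;>
    simpa using congrArg List.length (h.symm.trans h')

lemma Transposition.ne {u v : ShuffleWord m n} (h : Transposition u v) : u ≠ v := by
  rintro rfl
  obtain ⟨a, b, i, j, h, h'⟩ := h
  simpa using h.symm.trans h'

lemma ShuffleWord.lt_of_le_of_ne {u v : ShuffleWord m n} (h : u ≤ v) (hne : u ≠ v) : u < v :=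
  lt_of_le_not_ge h fun h' => hne (eq_of_below (below_of_le h) (below_of_le h'))

lemma ShuffleWord.covBy_of_below {u v : ShuffleWord m n} (h : u ≤ v) (hne : u ≠ v)
    (hb : ∀ w : ShuffleWord m n, u.Below w → w.Below v → w.Below u ∨ v.Below w) : u ⋖ v := by
  refine ⟨lt_of_le_of_ne h hne, fun w h1 h2 => ?_⟩
  rcases hb w (below_of_le h1.le) (below_of_le h2.le) with h | h
  · exact h1.ne (eq_of_below (below_of_le h1.le) h)
  · exact h2.ne (eq_of_below (below_of_le h2.le) h)

lemma RightIndel.indel {u v : ShuffleWord m n} (h : RightIndel u v) : Indel u v := by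
  rcases h with ⟨a, b, i, hu, hv, -⟩ | ⟨a, b, i, hu, hv, -⟩
  · exact Or.inl ⟨a, b, i, hu, hv⟩
  · exact Or.inr ⟨a, b, i, hu, hv⟩

/-- The two words differ only in the inversion of `x_i` and `y_j`; an intermediate word agrees with
one of them according to whether it has this inversion. -/
lemma Transposition.covBy {u v : ShuffleWord m n} (h : Transposition u v) : u ⋖ v := by
  refine ShuffleWord.covBy_of_below h.le h.ne fun w h1 h2 => ?_
  obtain ⟨a, b, i, j, hu, hv⟩ := h
  have hmem : ∀ l, l ∈ u.word ↔ l ∈ v.word := by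
    intro l
    rw [hu, hv]
    simp only [List.mem_append, List.mem_cons]
    tauto
  have hinv : ∀ k l, (k, l) ≠ (i, j) → (NoInversion u.word k l ↔ NoInversion v.word k l) := by
    intro k l hkl
    rw [hu, hv]
    simp at hkl ⊢
    grind
  have hi : Sum.inl i ∈ v.word := by simp [hv]
  have hv' : ¬ NoInversion v.word i j := by simp [hv]
  by_cases hw : NoInversion w.word i j
  · refine Or.inl ⟨fun k hk => h2.left k ((hmem _).1 hk), fun l hl => (hmem _).2 (h2.right l hl),
      fun k l hk hkl => ?_⟩
    by_cases he : (k, l) = (i, j)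
    · cases he
      exact hw
    · exact h2.inversion k l ((hmem _).1 hk) ((hinv k l he).1 hkl)
  · refine Or.inr ⟨fun k hk => (hmem _).1 (h1.left k hk), fun l hl => h1.right l ((hmem _).2 hl),
      fun k l hk hkl => ?_⟩
    have he : (k, l) ≠ (i, j) := by
      rintro he
      cases he
      exact hw hkl
    exact (hinv k l he).1 (h1.inversion k l hk hkl)

/-- An intermediate word `w` either contains the moved letter or not, and this decides which end it
equals. The delicate point is the position of that letter in `w`, which its right neighbour of the
same kind controls. -/
lemma RightIndel.covBy {u v : ShuffleWord m n} (h : RightIndel u v) : u ⋖ v := by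
  refine ShuffleWord.covBy_of_below h.indel.le h.indel.ne fun w h1 h2 => ?_
  rcases h with ⟨a, b, i, hu, hv, hb⟩ | ⟨a, b, j, hu, hv, hb⟩
  · have hn := u.nodup
    have ho := u.ordered
    rw [hu, List.nodup_middle, List.nodup_cons] at hn
    rw [hu, List.pairwise_append, List.pairwise_cons] at ho
    have hmemr : ∀ j, Sum.inr j ∈ u.word ↔ Sum.inr j ∈ v.word := by simp [hu, hv]
    have hmeml : ∀ k, Sum.inl k ∈ u.word ↔ k = i ∨ Sum.inl k ∈ v.word := by
      simp [hu, hv, or_left_comm]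
    have hiv : Sum.inl i ∉ v.word := by rw [hv]; exact hn.1
    have hinv : ∀ k j, k ≠ i → (NoInversion u.word k j ↔ NoInversion v.word k j) := by
      intro k j hk
      simp [hu, hv, hk]
    by_cases hw : Sum.inl i ∈ w.word
    · refine Or.inl ⟨?_, fun j hj => (hmemr j).2 (h2.right j hj), fun k j hk hkj => ?_⟩
      · intro k hk
        rcases (hmeml k).1 hk with rfl | hk
        · exact hw
        · exact h2.left k hk
      · by_cases hki : k = i
        · subst hki
          have hja : Sum.inr j ∉ a := by
            intro hja
            simp [hu, hja] at hkj
          -- If `x_k` ends `u`, then `v` is `a` and lacks `y_j`, hence so does `w`. Otherwise `y_j`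
          -- before `x_k` in `w` would be before `x_{i'}`, and this inversion would persist to `v`,
          -- where only `a` precedes `x_{i'}`.
          rcases hb with rfl | ⟨i', c, rfl⟩
          · refine noInversion_of_notMem_right (fun hj => hja ?_) k
            simpa [hv] using h2.right j hj
          · have hlt : k < i' := by simpa [MayPrecede] using ho.2.1.1 (Sum.inl i') (by simp)
            have hi' : Sum.inl i' ∈ v.word := by simp [hv]
            refine NoInversion.of_lt_left w.ordered hlt (h2.left i' hi') ?_
            refine h2.inversion i' j hi' ?_
            have hc : Sum.inl i' ∉ c := by
              have := v.nodup
              rw [hv, List.nodup_middle, List.nodup_cons] at this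
              exact fun h => this.1 (List.mem_append_right _ h)
            simp [hv, hja, noInversion_of_notMem_right hja, noInversion_of_notMem_left hc]
        · have hkv := ((hmeml k).1 hk).resolve_left hki
          exact h2.inversion k j hkv ((hinv k j hki).1 hkj)
    · refine Or.inr ⟨fun k hk => ?_, fun j hj => h1.right j ((hmemr j).2 hj), fun k j hk hkj => ?_⟩
      · exact ((hmeml k).1 (h1.left k hk)).resolve_left (by rintro rfl; exact hw hk)
      · rw [← hinv k j (by rintro rfl; exact hw hk)]
        exact h1.inversion k j hk hkj
  · have hn := v.nodup
    have ho := v.ordered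
    rw [hv, List.nodup_middle, List.nodup_cons] at hn
    rw [hv, List.pairwise_append, List.pairwise_cons] at ho
    have hmeml : ∀ k, Sum.inl k ∈ u.word ↔ Sum.inl k ∈ v.word := by simp [hu, hv]
    have hmemr : ∀ l, Sum.inr l ∈ v.word ↔ l = j ∨ Sum.inr l ∈ u.word := by
      simp [hu, hv, or_left_comm]
    have hju : Sum.inr j ∉ u.word := by rw [hu]; exact hn.1
    have hinv : ∀ k l, l ≠ j → (NoInversion u.word k l ↔ NoInversion v.word k l) := by
      intro k l hl
      simp [hu, hv, Ne.symm hl]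
    by_cases hw : Sum.inr j ∈ w.word
    · refine Or.inr ⟨fun k hk => (hmeml k).1 (h1.left k hk), ?_, fun k l hk hkl => ?_⟩
      · intro l hl
        rcases (hmemr l).1 hl with rfl | hl
        · exact hw
        · exact h1.right l hl
      · by_cases hlj : l = j
        · subst hlj
          by_contra hc
          have hkb : Sum.inl k ∈ b := by
            by_contra hkb
            refine hc ?_
            have := noInversion_of_notMem_right hju k
            rw [hu] at this
            simp only [noInversion_append] at this
            simp [hv, hkb, this.1, this.2.1]
          -- In `u` the letter `y_{l'}` precedes `x_k`. This inversion persists to `w`, where `y_l`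
          -- stands before `y_{l'}` and hence before `x_k`.
          rcases hb with rfl | ⟨l', c, rfl⟩
          · simp at hkb
          · have hlt : l < l' := by simpa [MayPrecede] using ho.2.1.1 (Sum.inr l') (by simp)
            have := h1.inversion k l' hk (NoInversion.of_lt_right w.ordered hlt hw hkl)
            rw [hu] at this
            simp at this hkb
            tauto
        · exact (hinv k l hlj).1 (h1.inversion k l hk hkl)
    · refine Or.inl ⟨fun k hk => h2.left k ((hmeml k).1 hk), fun l hl => ?_, fun k l hk hkl => ?_⟩
      · exact ((hmemr l).1 (h2.right l hl)).resolve_left (by rintro rfl; exact hw hl)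
      · by_cases hlj : l = j
        · subst hlj
          exact noInversion_of_notMem_right hw k
        · exact h2.inversion k l ((hmeml k).1 hk) ((hinv k l hlj).1 hkl)

lemma pairwise_mayPrecede_swap {a b : List (Letter m n)} {i : Fin m} {j : Fin n} :
    (a ++ Sum.inl i :: Sum.inr j :: b).Pairwise MayPrecede ↔
      (a ++ Sum.inr j :: Sum.inl i :: b).Pairwise MayPrecede := by
  have h1 : MayPrecede (Sum.inl i : Letter m n) (Sum.inr j) := trivial
  have h2 : MayPrecede (Sum.inr j : Letter m n) (Sum.inl i) := trivial
  simp only [List.pairwise_append, List.pairwise_cons, List.mem_cons, forall_eq_or_imp, h1, h2]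
  grind

/-- An indel that is not a right indel is never a cover: deleting `x` in front of `y` factors as `xy
→ yx → y`, and inserting `y` in front of `x` as `x → xy → yx`. -/
lemma covBy_iff {u v : ShuffleWord m n} : u ⋖ v ↔ RightIndel u v ∨ Transposition u v := by
  refine ⟨fun h => ?_, fun h => h.elim RightIndel.covBy Transposition.covBy⟩
  obtain rfl | ⟨w, hstep, hwv⟩ := Relation.ReflTransGen.cases_head h.le
  · exact absurd h.lt (lt_irrefl _)
  have hne : u ≠ w := hstep.elim Indel.ne Transposition.ne
  have huw : u < w :=
    ShuffleWord.lt_of_le_of_ne (hstep.elim Indel.le Transposition.le) hne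
  obtain rfl : w = v := by
    by_contra hc
    exact h.2 huw (ShuffleWord.lt_of_le_of_ne hwv hc)
  refine hstep.imp_left fun hs => ?_
  have key : ∀ z : ShuffleWord m n, (Indel u z ∧ Transposition z w) ∨
      (Transposition u z ∧ Indel z w) → False := by
    rintro z (⟨h1, h2⟩ | ⟨h1, h2⟩)
    · exact h.2 (ShuffleWord.lt_of_le_of_ne h1.le h1.ne) (ShuffleWord.lt_of_le_of_ne h2.le h2.ne)
    · exact h.2 (ShuffleWord.lt_of_le_of_ne h1.le h1.ne) (ShuffleWord.lt_of_le_of_ne h2.le h2.ne)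
  rcases hs with ⟨a, b, i, hu, hv⟩ | ⟨a, b, j, hu, hv⟩
  · rcases b with _ | ⟨i' | j', c⟩
    · exact Or.inl ⟨a, _, i, hu, hv, Or.inl rfl⟩
    · exact Or.inl ⟨a, _, i, hu, hv, Or.inr ⟨i', c, rfl⟩⟩
    · refine (key ⟨a ++ Sum.inr j' :: Sum.inl i :: c,
        pairwise_mayPrecede_swap.1 (hu ▸ u.ordered)⟩ (Or.inr ⟨⟨a, c, i, j', hu, rfl⟩,
          Or.inl ⟨a ++ [Sum.inr j'], c, i, by simp, by simp [hv]⟩⟩)).elim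
  · rcases b with _ | ⟨i' | j', c⟩
    · exact Or.inr ⟨a, _, j, hu, hv, Or.inl rfl⟩
    · refine (key ⟨a ++ Sum.inl i' :: Sum.inr j :: c,
        pairwise_mayPrecede_swap.2 (hv ▸ w.ordered)⟩ (Or.inl ⟨Or.inr
          ⟨a ++ [Sum.inl i'], c, j, by simp [hu], by simp⟩, ⟨a, c, i', j, rfl, hv⟩⟩)).elim
    · exact Or.inr ⟨a, _, j, hu, hv, Or.inr ⟨j', c, rfl⟩⟩

end Inversions

/-! ### Degrees in terms of letter counts and descents -/

section Degrees

variable {m n : ℕ}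

/-- The word starts with a letter of `X`. -/
def startsLeft : List (Letter m n) → Bool
  | Sum.inl _ :: _ => true
  | _ => false

/-- The number of consecutive subwords of the form `yx`. -/
def descents : List (Letter m n) → ℕ
  | [] => 0
  | p :: l => descents l + if p.isRight && startsLeft l then 1 else 0

lemma descents_le_countP (l : List (Letter m n)) : descents l ≤ l.countP (·.isRight) := by
  induction l with
  | nil => simp [descents]
  | cons p l ih =>
    rw [List.countP_cons, descents]
    refine add_le_add ih ?_
    split_ifs <;> simp_all

lemma not_startsLeft_iff {l : List (Letter m n)} :
    startsLeft l = false ↔ l = [] ∨ ∃ (j : Fin n) (c : List (Letter m n)), l = Sum.inr j :: c := by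
  rcases l with _ | ⟨i | j, l⟩ <;> simp [startsLeft]

lemma countP_isLeft_eq_ncard {l : List (Letter m n)} (h : l.Nodup) :
    l.countP (·.isLeft) = {i | Sum.inl i ∈ l}.ncard := by
  induction l with
  | nil => simp
  | cons p l ih =>
    rw [List.nodup_cons] at h
    rw [List.countP_cons, ih h.2]
    rcases p with i | j
    · have : {k | Sum.inl k ∈ (Sum.inl i : Letter m n) :: l} = insert i {k | Sum.inl k ∈ l} := by
        ext k
        simp
      rw [this, Set.ncard_insert_of_notMem (by simpa using h.1)]
      simp
    · simp

lemma countP_isRight_eq_ncard {l : List (Letter m n)} (h : l.Nodup) :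
    l.countP (·.isRight) = {j | Sum.inr j ∈ l}.ncard := by
  induction l with
  | nil => simp
  | cons p l ih =>
    rw [List.nodup_cons] at h
    rw [List.countP_cons, ih h.2]
    rcases p with i | j
    · simp
    · have : {k | Sum.inr k ∈ (Sum.inr j : Letter m n) :: l} = insert j {k | Sum.inr k ∈ l} := by
        ext k
        simp
      rw [this, Set.ncard_insert_of_notMem (by simpa using h.1)]
      simp

lemma countP_isRight_le (u : ShuffleWord m n) : u.word.countP (·.isRight) ≤ n := by
  rw [countP_isRight_eq_ncard u.nodup]
  exact (Set.ncard_le_card _).trans_eq (by simp)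

lemma countP_isLeft_le (u : ShuffleWord m n) : u.word.countP (·.isLeft) ≤ m := by
  rw [countP_isLeft_eq_ncard u.nodup]
  exact (Set.ncard_le_card _).trans_eq (by simp)

/-- The words from which a forward transposition leads to `l`. -/
def transpositionSources (l : List (Letter m n)) : Set (List (Letter m n)) :=
  {w | ∃ (a b : List (Letter m n)) (i : Fin m) (j : Fin n),
    w = a ++ Sum.inl i :: Sum.inr j :: b ∧ l = a ++ Sum.inr j :: Sum.inl i :: b}

lemma transpositionSources_cons (p : Letter m n) (l : List (Letter m n)) :
    transpositionSources (p :: l) = List.cons p '' transpositionSources l ∪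
      {w | ∃ (b : List (Letter m n)) (i : Fin m) (j : Fin n),
        w = Sum.inl i :: Sum.inr j :: b ∧ p = Sum.inr j ∧ l = Sum.inl i :: b} := by
  ext w
  constructor
  · rintro ⟨_ | ⟨p', a⟩, b, i, j, rfl, h⟩
    · simp only [List.nil_append, List.cons.injEq] at h
      exact Or.inr ⟨b, i, j, rfl, h⟩
    · simp only [List.cons_append, List.cons.injEq] at h
      obtain ⟨rfl, h⟩ := h
      exact Or.inl ⟨_, ⟨a, b, i, j, rfl, h⟩, rfl⟩
  · rintro (⟨_, ⟨a, b, i, j, rfl, rfl⟩, rfl⟩ | ⟨b, i, j, rfl, rfl, rfl⟩)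
    · exact ⟨p :: a, b, i, j, rfl, rfl⟩
    · exact ⟨[], b, i, j, rfl, rfl⟩

lemma transpositionSources_finite_ncard (l : List (Letter m n)) :
    (transpositionSources l).Finite ∧ (transpositionSources l).ncard = descents l := by
  induction l with
  | nil => simp [transpositionSources, descents]
  | cons p l ih =>
    rw [transpositionSources_cons, descents, ← ih.2,
      ← Set.ncard_image_of_injective (transpositionSources l) (List.cons_injective (a := p))]
    have hfin := ih.1.image (List.cons p)
    by_cases h : p.isRight && startsLeft l
    · rw [if_pos h]
      rcases p with i | j
      · simp at h
      rcases l with _ | ⟨i | j', l⟩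
      · simp [startsLeft] at h
      · have : {w : List (Letter m n) | ∃ (b : List (Letter m n)) (i' : Fin m) (j' : Fin n),
            w = Sum.inl i' :: Sum.inr j' :: b ∧ (Sum.inr j : Letter m n) = Sum.inr j' ∧
              (Sum.inl i : Letter m n) :: l = Sum.inl i' :: b} =
            {Sum.inl i :: Sum.inr j :: l} := by
          ext w
          simp
        rw [this]
        refine ⟨hfin.union (Set.finite_singleton _), ?_⟩
        rw [Set.ncard_union_eq (by simp) hfin, Set.ncard_singleton]
      · simp [startsLeft] at h
    · have : {w : List (Letter m n) | ∃ (b : List (Letter m n)) (i : Fin m) (j : Fin n),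
          w = Sum.inl i :: Sum.inr j :: b ∧ p = Sum.inr j ∧ l = Sum.inl i :: b} = ∅ := by
        refine Set.eq_empty_iff_forall_notMem.2 ?_
        rintro w ⟨b, i, j, rfl, rfl, rfl⟩
        simp [startsLeft] at h
      rw [if_neg h, this, Set.union_empty]
      exact ⟨hfin, rfl⟩

lemma ncard_transposition (u : ShuffleWord m n) :
    {u' | Transposition u' u}.ncard = descents u.word := by
  rw [← (transpositionSources_finite_ncard u.word).2,
    ← Set.ncard_image_of_injective _ (fun _ _ => ShuffleWord.ext :
      Function.Injective (ShuffleWord.word (m := m) (n := n)))]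
  congr 1
  ext w
  constructor
  · rintro ⟨u', ⟨a, b, i, j, h, h'⟩, rfl⟩
    exact ⟨a, b, i, j, h, h'⟩
  · rintro ⟨a, b, i, j, rfl, h⟩
    exact ⟨⟨_, pairwise_mayPrecede_swap.2 (h ▸ u.ordered)⟩, ⟨a, b, i, j, rfl, h⟩, rfl⟩

/-- The words from which a right indel inserting a letter of `Y` leads to `l`. -/
def insertionSources (l : List (Letter m n)) : Set (List (Letter m n)) :=
  {w | ∃ (a b : List (Letter m n)) (j : Fin n),
    w = a ++ b ∧ l = a ++ Sum.inr j :: b ∧ startsLeft b = false}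

lemma insertionSources_cons (p : Letter m n) (l : List (Letter m n)) :
    insertionSources (p :: l) = List.cons p '' insertionSources l ∪
      {w | w = l ∧ (p.isRight && !startsLeft l)} := by
  ext w
  constructor
  · rintro ⟨_ | ⟨p', a⟩, b, j, rfl, h, hb⟩
    · simp only [List.nil_append, List.cons.injEq] at h
      obtain ⟨rfl, rfl⟩ := h
      exact Or.inr (by simp [hb])
    · simp only [List.cons_append, List.cons.injEq] at h
      obtain ⟨rfl, h⟩ := h
      exact Or.inl ⟨_, ⟨a, b, j, rfl, h, hb⟩, rfl⟩
  · rintro (⟨_, ⟨a, b, j, rfl, rfl, hb⟩, rfl⟩ | ⟨rfl, h⟩)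
    · exact ⟨p :: a, b, j, rfl, rfl, hb⟩
    · rcases p with i | j
      · simp at h
      · exact ⟨[], w, j, rfl, rfl, by simpa using h⟩

/-- A letter of `Y` can be the inserted one exactly when it does not begin a descent. Different
choices give different sources because no letter is repeated. -/
lemma insertionSources_finite_ncard {l : List (Letter m n)} (hl : l.Nodup) :
    (insertionSources l).Finite ∧
      (insertionSources l).ncard + descents l = l.countP (·.isRight) := by
  induction l with
  | nil => simp [insertionSources, descents]
  | cons p l ih =>
    rw [List.nodup_cons] at hl
    obtain ⟨hfin, ih⟩ := ih hl.2
    replace hfin := hfin.image (List.cons p)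
    rw [insertionSources_cons, descents, List.countP_cons, ← ih,
      ← Set.ncard_image_of_injective (insertionSources l) (List.cons_injective (a := p))]
    by_cases h : p.isRight && !startsLeft l
    · simp only [h, and_true, Set.ofPred_eq_eq_singleton]
      have hn : Disjoint (List.cons p '' insertionSources l) {l} := by
        rw [Set.disjoint_singleton_right]
        rintro ⟨w, -, rfl⟩
        exact hl.1 List.mem_cons_self
      refine ⟨hfin.union (Set.finite_singleton _), ?_⟩
      rw [Set.ncard_union_eq hn hfin, Set.ncard_singleton]
      simp only [Bool.and_eq_true, Bool.not_eq_true'] at h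
      simp [h.1, h.2]
      omega
    · have : {w | w = l ∧ (p.isRight && !startsLeft l)} = (∅ : Set (List (Letter m n))) :=
        Set.eq_empty_iff_forall_notMem.2 fun w hw => h hw.2
      rw [this, Set.union_empty]
      refine ⟨hfin, ?_⟩
      cases hp : p.isRight <;> simp_all
      omega

/-- The missing `x_i` goes directly before the first letter of `X` with a larger index, or to the
end if there is none. -/
lemma exists_insert_left {u : ShuffleWord m n} {i : Fin m} (hi : Sum.inl i ∉ u.word) :
    ∃ (u' : ShuffleWord m n) (a b : List (Letter m n)), u'.word = a ++ Sum.inl i :: b ∧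
      u.word = a ++ b ∧ (b = [] ∨ ∃ (i' : Fin m) (c : List (Letter m n)), b = Sum.inl i' :: c) := by
  obtain ⟨a, b, hab, ha, hb⟩ : ∃ a b, u.word = a ++ b ∧ (∀ k, Sum.inl k ∈ a → k < i) ∧
      (b = [] ∨ ∃ (i' : Fin m) (c : List (Letter m n)), b = Sum.inl i' :: c ∧ i < i') := by
    generalize u.word = l at hi
    induction l with
    | nil => exact ⟨[], [], by simp⟩
    | cons p l ih =>
      simp only [List.mem_cons, not_or] at hi
      obtain ⟨a, b, hab, ha, hb⟩ := ih hi.2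
      by_cases hp : ∃ k, i < k ∧ p = Sum.inl k
      · obtain ⟨k, hk, rfl⟩ := hp
        exact ⟨[], _, rfl, by simp, Or.inr ⟨k, l, rfl, hk⟩⟩
      · refine ⟨p :: a, b, by simp [hab], fun k hk => ?_, hb⟩
        rcases List.mem_cons.1 hk with rfl | hk'
        · exact lt_of_le_of_ne (not_lt.1 fun h => hp ⟨k, h, rfl⟩) fun h => hi.1 (by rw [h])
        · exact ha k hk'
  have ho := u.ordered
  rw [hab, List.pairwise_append] at ho
  refine ⟨⟨a ++ Sum.inl i :: b, ?_⟩, a, b, rfl, hab, ?_⟩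
  · rw [List.pairwise_append, List.pairwise_cons]
    refine ⟨ho.1, ⟨?_, ho.2.1⟩, fun x hx y hy => ?_⟩
    · rcases hb with rfl | ⟨i', c, rfl, hlt⟩
      · simp
      · rintro (k | k) hk
        · rcases List.mem_cons.1 hk with hk | hk
          · cases hk
            exact hlt
          · exact hlt.trans ((List.pairwise_cons.1 ho.2.1).1 _ hk)
        · trivial
    · rcases List.mem_cons.1 hy with rfl | hy
      · rcases x with k | k
        · exact ha k hx
        · trivial
      · exact ho.2.2 x hx y hy
  · exact hb.imp_right fun ⟨i', c, h, _⟩ => ⟨i', c, h⟩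

/-- If the places differed, the earlier one would be followed by some `x_{i'}` lying before the
later one, forcing both `i < i'` and `i' < i`. -/
lemma insert_left_unique {a b a' b' : List (Letter m n)} {i : Fin m}
    (ho : (a ++ Sum.inl i :: b).Pairwise MayPrecede)
    (ho' : (a' ++ Sum.inl i :: b').Pairwise MayPrecede) (h : a ++ b = a' ++ b')
    (hb : b = [] ∨ ∃ (i' : Fin m) (c : List (Letter m n)), b = Sum.inl i' :: c)
    (hb' : b' = [] ∨ ∃ (i' : Fin m) (c : List (Letter m n)), b' = Sum.inl i' :: c) :
    a = a' ∧ b = b' := by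
  rw [List.pairwise_append, List.pairwise_cons] at ho ho'
  rcases List.append_eq_append_iff.1 h with ⟨c, rfl, rfl⟩ | ⟨c, rfl, rfl⟩
  · rcases c with _ | ⟨p, c⟩
    · simp
    · obtain ⟨i', d, hd⟩ := hb.resolve_left (by simp)
      simp only [List.cons_append, List.cons.injEq] at hd
      obtain ⟨rfl, rfl⟩ := hd
      have h1 : i < i' := ho.2.1.1 (Sum.inl i') (by simp)
      have h2 : i' < i := ho'.2.2 (Sum.inl i') (by simp) (Sum.inl i) (by simp)
      exact absurd h1 (lt_asymm h2)
  · rcases c with _ | ⟨p, c⟩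
    · simp
    · obtain ⟨i', d, hd⟩ := hb'.resolve_left (by simp)
      simp only [List.cons_append, List.cons.injEq] at hd
      obtain ⟨rfl, rfl⟩ := hd
      have h1 : i < i' := ho'.2.1.1 (Sum.inl i') (by simp)
      have h2 : i' < i := ho.2.2 (Sum.inl i') (by simp) (Sum.inl i) (by simp)
      exact absurd h1 (lt_asymm h2)

lemma ncard_deletion (u : ShuffleWord m n) :
    {u' : ShuffleWord m n | ∃ (a b : List (Letter m n)) (i : Fin m),
      u'.word = a ++ Sum.inl i :: b ∧ u.word = a ++ b ∧
        (b = [] ∨ ∃ (i' : Fin m) (c : List (Letter m n)), b = Sum.inl i' :: c)}.ncard =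
      {i : Fin m | Sum.inl i ∉ u.word}.ncard := by
  symm
  refine Set.ncard_congr (fun i hi => (exists_insert_left (u := u) hi).choose) ?_ ?_ ?_
  · intro i hi
    obtain ⟨a, b, h⟩ := (exists_insert_left (u := u) hi).choose_spec
    exact ⟨a, b, i, h⟩
  · intro i i' hi hi' h
    obtain ⟨a, b, h1, h2, -⟩ := (exists_insert_left (u := u) hi).choose_spec
    obtain ⟨a', b', h1', h2', -⟩ := (exists_insert_left (u := u) hi').choose_spec
    have hm : Sum.inl i ∈ a' ++ Sum.inl i' :: b' := by
      rw [← h1', ← h, h1]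
      simp
    have hi : Sum.inl i ∉ a' ++ b' := h2' ▸ hi
    simp at hm hi
    tauto
  · rintro u' ⟨a, b, i, h1, h2, h3⟩
    have hi : Sum.inl i ∉ u.word := by
      have := u'.nodup
      rw [h1, List.nodup_middle, List.nodup_cons] at this
      rw [h2]
      exact this.1
    refine ⟨i, hi, ?_⟩
    obtain ⟨a', b', h1', h2', h3'⟩ := (exists_insert_left (u := u) hi).choose_spec
    obtain ⟨rfl, rfl⟩ := insert_left_unique (h1 ▸ u'.ordered)
      (h1' ▸ (exists_insert_left (u := u) hi).choose.ordered) (h2.symm.trans h2') h3 h3'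
    exact ShuffleWord.ext (h1'.trans h1.symm)

lemma ncard_insertion (u : ShuffleWord m n) :
    {u' : ShuffleWord m n | ∃ (a b : List (Letter m n)) (j : Fin n),
      u'.word = a ++ b ∧ u.word = a ++ Sum.inr j :: b ∧
        (b = [] ∨ ∃ (j' : Fin n) (c : List (Letter m n)), b = Sum.inr j' :: c)}.ncard =
      (insertionSources u.word).ncard := by
  rw [← Set.ncard_image_of_injective _ (fun _ _ => ShuffleWord.ext :
      Function.Injective (ShuffleWord.word (m := m) (n := n)))]
  congr 1
  ext w
  simp only [insertionSources, not_startsLeft_iff]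
  constructor
  · rintro ⟨u', ⟨a, b, j, h⟩, rfl⟩
    exact ⟨a, b, j, h⟩
  · rintro ⟨a, b, j, rfl, h, hb⟩
    refine ⟨⟨_, u.ordered.sublist ?_⟩, ⟨a, b, j, rfl, h, hb⟩, rfl⟩
    rw [h]
    exact (List.Sublist.refl a).append (List.sublist_cons_self _ _)

/-- Deletions and insertions into `u` are disjoint, since they change the length in opposite
directions. The identity is kept additive to avoid truncated subtraction. -/
lemma indelDegree_add (u : ShuffleWord m n) :
    indelDegree u + u.word.countP (·.isLeft) + descents u.word =
      m + u.word.countP (·.isRight) := by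
  have h : indelDegree u = {i : Fin m | Sum.inl i ∉ u.word}.ncard +
      (insertionSources u.word).ncard := by
    rw [← ncard_deletion, ← ncard_insertion, ← Set.ncard_union_eq _ (Set.toFinite _)
      (Set.toFinite _)]
    · rfl
    · rw [Set.disjoint_left]
      rintro u' ⟨a, b, i, h1, h2, -⟩ ⟨a', b', j, h1', h2', -⟩
      have h := congrArg List.length h1
      have h' := congrArg List.length h2
      rw [h1'] at h
      rw [h2'] at h'
      simp at h h'
      omega
  have h1 := Set.ncard_add_ncard_compl {i : Fin m | Sum.inl i ∈ u.word}
  rw [← countP_isLeft_eq_ncard u.nodup, Nat.card_fin] at h1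
  have h2 : {i : Fin m | Sum.inl i ∈ u.word}ᶜ = {i : Fin m | Sum.inl i ∉ u.word} := rfl
  have h3 := (insertionSources_finite_ncard u.nodup).2
  rw [h2] at h1
  omega

lemma inDegree_eq (u : ShuffleWord m n) : inDegree u = indelDegree u + descents u.word := by
  rw [inDegree, indelDegree, ← ncard_transposition, ← Set.ncard_union_eq _ (Set.toFinite _)
    (Set.toFinite _)]
  · congr 1
    ext u'
    exact covBy_iff
  · rw [Set.disjoint_left]
    rintro u' h ⟨a, b, i, j, h1, h2⟩
    have hl : u'.word.length = u.word.length := by simp [h1, h2]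
    rcases h.indel with ⟨a, b, i, h1, h2⟩ | ⟨a, b, i, h1, h2⟩ <;> simp [h1, h2] at hl

end Degrees

/-! ### Recurrence for the weighted sum over words -/

section WordSum

variable {m n : ℕ}

/-- The word over a larger alphabet obtained by raising the indices of the letters of `X`. -/
def ShuffleWord.liftLeft (u : ShuffleWord m n) : ShuffleWord (m + 1) n where
  word := u.word.map (Sum.map Fin.succ id)
  ordered := by
    refine List.pairwise_map.2 (u.ordered.imp ?_)
    rintro (i | j) (i' | j') h <;> simp_all [MayPrecede]

/-- The word over a larger alphabet obtained by raising the indices of the letters of `Y`. -/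
def ShuffleWord.liftRight (u : ShuffleWord m n) : ShuffleWord m (n + 1) where
  word := u.word.map (Sum.map id Fin.succ)
  ordered := by
    refine List.pairwise_map.2 (u.ordered.imp ?_)
    rintro (i | j) (i' | j') h <;> simp_all [MayPrecede]

/-- Raise the indices of the letters of `X` and put the new first letter of `X` in front. -/
def ShuffleWord.consLeft (u : ShuffleWord m n) : ShuffleWord (m + 1) n where
  word := Sum.inl 0 :: u.liftLeft.word
  ordered := by
    refine List.pairwise_cons.2 ⟨?_, u.liftLeft.ordered⟩
    rintro (i | j) h
    · obtain ⟨i' | j', -, h⟩ := List.mem_map.1 h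
      · cases h
        exact Fin.succ_pos _
      · cases h
    · trivial

/-- Raise the indices of the letters of `Y` and put the new first letter of `Y` in front. -/
def ShuffleWord.consRight (u : ShuffleWord m n) : ShuffleWord m (n + 1) where
  word := Sum.inr 0 :: u.liftRight.word
  ordered := by
    refine List.pairwise_cons.2 ⟨?_, u.liftRight.ordered⟩
    rintro (i | j) h
    · trivial
    · obtain ⟨i' | j', -, h⟩ := List.mem_map.1 h
      · cases h
      · cases h
        exact Fin.succ_pos _

lemma ShuffleWord.liftLeft_injective :
    Function.Injective (ShuffleWord.liftLeft (m := m) (n := n)) := fun _ _ h =>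
  ShuffleWord.ext (List.map_injective_iff.2
    ((Fin.succ_injective _).sumMap Function.injective_id) (congrArg ShuffleWord.word h))

lemma ShuffleWord.liftRight_injective :
    Function.Injective (ShuffleWord.liftRight (m := m) (n := n)) := fun _ _ h =>
  ShuffleWord.ext (List.map_injective_iff.2
    (Function.injective_id.sumMap (Fin.succ_injective _)) (congrArg ShuffleWord.word h))

lemma ShuffleWord.consLeft_injective :
    Function.Injective (ShuffleWord.consLeft (m := m) (n := n)) := fun _ _ h =>
  liftLeft_injective (ShuffleWord.ext (List.cons_inj_right _ |>.1 (congrArg ShuffleWord.word h)))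

lemma ShuffleWord.consRight_injective :
    Function.Injective (ShuffleWord.consRight (m := m) (n := n)) := fun _ _ h =>
  liftRight_injective (ShuffleWord.ext (List.cons_inj_right _ |>.1 (congrArg ShuffleWord.word h)))

lemma ShuffleWord.zero_notMem_liftLeft (u : ShuffleWord m n) : Sum.inl 0 ∉ u.liftLeft.word := by
  simp [liftLeft]

lemma ShuffleWord.zero_notMem_liftRight (u : ShuffleWord m n) :
    Sum.inr 0 ∉ u.liftRight.word := by
  simp [liftRight]

lemma ShuffleWord.exists_liftLeft {u : ShuffleWord (m + 1) n} (h : Sum.inl 0 ∉ u.word) :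
    ∃ v : ShuffleWord m n, v.liftLeft = u := by
  obtain ⟨l, hl⟩ : u.word ∈ Set.range (List.map (Sum.map Fin.succ id : Letter m n → _)) := by
    rw [Set.range_list_map]
    rintro (i | j) hx
    · obtain ⟨i', rfl⟩ := Fin.exists_succ_eq.2 (fun hi => h (hi ▸ hx) : i ≠ 0)
      exact ⟨Sum.inl i', rfl⟩
    · exact ⟨Sum.inr j, rfl⟩
  refine ⟨⟨l, ?_⟩, ShuffleWord.ext hl⟩
  have := u.ordered
  rw [← hl, List.pairwise_map] at this
  refine this.imp ?_
  rintro (i | j) (i' | j') h <;> simp_all [MayPrecede]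

lemma ShuffleWord.exists_liftRight {u : ShuffleWord m (n + 1)} (h : Sum.inr 0 ∉ u.word) :
    ∃ v : ShuffleWord m n, v.liftRight = u := by
  obtain ⟨l, hl⟩ : u.word ∈ Set.range (List.map (Sum.map id Fin.succ : Letter m n → _)) := by
    rw [Set.range_list_map]
    rintro (i | j) hx
    · exact ⟨Sum.inl i, rfl⟩
    · obtain ⟨j', rfl⟩ := Fin.exists_succ_eq.2 (fun hj => h (hj ▸ hx) : j ≠ 0)
      exact ⟨Sum.inr j', rfl⟩
  refine ⟨⟨l, ?_⟩, ShuffleWord.ext hl⟩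
  have := u.ordered
  rw [← hl, List.pairwise_map] at this
  refine this.imp ?_
  rintro (i | j) (i' | j') h <;> simp_all [MayPrecede]

lemma startsLeft_map {m' n' : ℕ} (f : Fin m → Fin m') (g : Fin n → Fin n')
    (l : List (Letter m n)) : startsLeft (l.map (Sum.map f g)) = startsLeft l := by
  rcases l with _ | ⟨i | j, l⟩ <;> rfl

lemma descents_map {m' n' : ℕ} (f : Fin m → Fin m') (g : Fin n → Fin n')
    (l : List (Letter m n)) : descents (l.map (Sum.map f g)) = descents l := by
  induction l with
  | nil => rfl
  | cons p l ih => simp [descents, ih, startsLeft_map]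

lemma countP_isLeft_map {m' n' : ℕ} (f : Fin m → Fin m') (g : Fin n → Fin n')
    (l : List (Letter m n)) :
    (l.map (Sum.map f g)).countP (·.isLeft) = l.countP (·.isLeft) := by
  simp [List.countP_map, Function.comp_def]

lemma countP_isRight_map {m' n' : ℕ} (f : Fin m → Fin m') (g : Fin n → Fin n')
    (l : List (Letter m n)) :
    (l.map (Sum.map f g)).countP (·.isRight) = l.countP (·.isRight) := by
  simp [List.countP_map, Function.comp_def]

/-- The word starts with a letter of `Y`. -/
def startsRight : List (Letter m n) → Bool
  | Sum.inr _ :: _ => true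
  | _ => false

lemma startsRight_map {m' n' : ℕ} (f : Fin m → Fin m') (g : Fin n → Fin n')
    (l : List (Letter m n)) : startsRight (l.map (Sum.map f g)) = startsRight l := by
  rcases l with _ | ⟨i | j, l⟩ <;> rfl

variable {R : Type*} [CommRing R] (q t : R)

/-- Letters of `X` in the word and letters of `Y` outside it have weight `q`, a letter of `Y`
followed by one of `X` has weight `q + 1`, all other letters have weight `1 + t`. -/
def wordWeight (u : ShuffleWord m n) : R :=
  q ^ (u.word.countP (·.isLeft)) * q ^ (n - u.word.countP (·.isRight)) *
    (q + 1) ^ descents u.word * (1 + t) ^ (m - u.word.countP (·.isLeft)) *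
      (1 + t) ^ (u.word.countP (·.isRight) - descents u.word)

lemma wordWeight_liftLeft (u : ShuffleWord m n) :
    wordWeight q t u.liftLeft = (1 + t) * wordWeight q t u := by
  simp only [wordWeight, ShuffleWord.liftLeft, countP_isLeft_map, countP_isRight_map, descents_map]
  rw [Nat.succ_sub (countP_isLeft_le u), pow_succ]
  ring

lemma wordWeight_liftRight (u : ShuffleWord m n) :
    wordWeight q t u.liftRight = q * wordWeight q t u := by
  simp only [wordWeight, ShuffleWord.liftRight, countP_isLeft_map, countP_isRight_map,
    descents_map]
  rw [Nat.succ_sub (countP_isRight_le u), pow_succ]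
  ring

lemma wordWeight_consLeft (u : ShuffleWord m n) :
    wordWeight q t u.consLeft = q * wordWeight q t u := by
  simp only [wordWeight, ShuffleWord.consLeft, ShuffleWord.liftLeft, countP_isLeft_map,
    countP_isRight_map, descents_map, List.countP_cons, descents]
  simp
  ring

lemma wordWeight_consRight (u : ShuffleWord m n) :
    wordWeight q t u.consRight =
      (if startsLeft u.word then q + 1 else 1 + t) * wordWeight q t u := by
  simp only [wordWeight, ShuffleWord.consRight, ShuffleWord.liftRight, countP_isLeft_map,
    countP_isRight_map, descents_map, List.countP_cons, descents, startsLeft_map]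
  by_cases h : startsLeft u.word
  · simp [h]
    ring
  · simp [h]
    rw [Nat.succ_sub (descents_le_countP _), pow_succ]
    ring

/-- The sum of the weights of all words. -/
noncomputable def wordSum (m n : ℕ) : R := ∑ u : ShuffleWord m n, wordWeight q t u

/-- The sum of the weights of the words starting with a letter of `X`. -/
noncomputable def wordSumLeft (m n : ℕ) : R := ∑ u : ShuffleWord m n with startsLeft u.word, wordWeight q t u

/-- The sum of the weights of the words starting with a letter of `Y`. -/
noncomputable def wordSumRight (m n : ℕ) : R := ∑ u : ShuffleWord m n with startsRight u.word, wordWeight q t u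

lemma wordSumLeft_zero (n : ℕ) : wordSumLeft q t 0 n = 0 := by
  refine Finset.sum_eq_zero fun u hu => ?_
  rcases u with ⟨_ | ⟨i | j, l⟩, h⟩
  · simp [startsLeft] at hu
  · exact i.elim0
  · simp [startsLeft] at hu

lemma wordSumRight_zero (m : ℕ) : wordSumRight q t m 0 = 0 := by
  refine Finset.sum_eq_zero fun u hu => ?_
  rcases u with ⟨_ | ⟨i | j, l⟩, h⟩
  · simp [startsRight] at hu
  · simp [startsRight] at hu
  · exact j.elim0

/-- A word starting in `X` that contains the first letter of `X` must start with it, followed by an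
arbitrary word in the other letters; if that letter is missing, only the indices shift. -/
lemma wordSumLeft_succ (m n : ℕ) :
    wordSumLeft q t (m + 1) n = q * wordSum q t m n + (1 + t) * wordSumLeft q t m n := by
  classical
  have h : ({u | startsLeft u.word} : Finset (ShuffleWord (m + 1) n)) =
      Finset.univ.image ShuffleWord.consLeft ∪
        Finset.image ShuffleWord.liftLeft {u : ShuffleWord m n | startsLeft u.word} := by
    ext u
    simp only [Finset.mem_filter, Finset.mem_univ, true_and, Finset.mem_union, Finset.mem_image]
    constructor
    · intro hu
      by_cases h0 : Sum.inl 0 ∈ u.word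
      · left
        rcases u with ⟨_ | ⟨i | j, l⟩, h⟩
        · simp [startsLeft] at hu
        · rw [List.pairwise_cons] at h
          have hl : Sum.inl 0 ∉ l := fun hc => Fin.not_lt_zero _ (h.1 _ hc)
          obtain ⟨v, hv⟩ := ShuffleWord.exists_liftLeft (u := ⟨l, h.2⟩) hl
          refine ⟨v, ShuffleWord.ext ?_⟩
          obtain rfl : 0 = i := by simpa [hl] using h0
          simp [ShuffleWord.consLeft, hv]
        · simp [startsLeft] at hu
      · obtain ⟨v, rfl⟩ := ShuffleWord.exists_liftLeft h0
        exact Or.inr ⟨v, by simpa [ShuffleWord.liftLeft, startsLeft_map] using hu, rfl⟩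
    · rintro (⟨v, rfl⟩ | ⟨v, hv, rfl⟩)
      · rfl
      · simpa [ShuffleWord.liftLeft, startsLeft_map] using hv
  rw [wordSumLeft, h, Finset.sum_union, Finset.sum_image ShuffleWord.consLeft_injective.injOn,
    Finset.sum_image ShuffleWord.liftLeft_injective.injOn, wordSum, wordSumLeft, Finset.mul_sum,
    Finset.mul_sum]
  · simp only [wordWeight_consLeft, wordWeight_liftLeft]
  · simp only [Finset.disjoint_left, Finset.mem_image, not_exists, not_and]
    rintro _ ⟨v, -, rfl⟩ w - hw
    exact w.zero_notMem_liftLeft (hw ▸ List.mem_cons_self)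

/-- As in `wordSumLeft_succ`, but a leading letter of `Y` has weight `q + 1` or `1 + t` according to
whether the rest starts in `X`. -/
lemma wordSumRight_succ (m n : ℕ) :
    wordSumRight q t m (n + 1) = (q + 1) * wordSumLeft q t m n +
      (1 + t) * (wordSum q t m n - wordSumLeft q t m n) + q * wordSumRight q t m n := by
  classical
  have h : ({u | startsRight u.word} : Finset (ShuffleWord m (n + 1))) =
      Finset.univ.image ShuffleWord.consRight ∪
        Finset.image ShuffleWord.liftRight {u : ShuffleWord m n | startsRight u.word} := by
    ext u
    simp only [Finset.mem_filter, Finset.mem_univ, true_and, Finset.mem_union, Finset.mem_image]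
    constructor
    · intro hu
      by_cases h0 : Sum.inr 0 ∈ u.word
      · left
        rcases u with ⟨_ | ⟨i | j, l⟩, h⟩
        · simp [startsRight] at hu
        · simp [startsRight] at hu
        · rw [List.pairwise_cons] at h
          have hl : Sum.inr 0 ∉ l := fun hc => Fin.not_lt_zero _ (h.1 _ hc)
          obtain ⟨v, hv⟩ := ShuffleWord.exists_liftRight (u := ⟨l, h.2⟩) hl
          refine ⟨v, ShuffleWord.ext ?_⟩
          obtain rfl : 0 = j := by simpa [hl] using h0
          simp [ShuffleWord.consRight, hv]
      · obtain ⟨v, rfl⟩ := ShuffleWord.exists_liftRight h0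
        exact Or.inr ⟨v, by simpa [ShuffleWord.liftRight, startsRight_map] using hu, rfl⟩
    · rintro (⟨v, rfl⟩ | ⟨v, hv, rfl⟩)
      · rfl
      · simpa [ShuffleWord.liftRight, startsRight_map] using hv
  have h' : wordSum q t m n - wordSumLeft q t m n =
      ∑ u : ShuffleWord m n with ¬ startsLeft u.word, wordWeight q t u := by
    rw [sub_eq_iff_eq_add', wordSum, wordSumLeft, Finset.sum_filter_add_sum_filter_not]
  rw [wordSumRight, h, Finset.sum_union, Finset.sum_image ShuffleWord.consRight_injective.injOn,
    Finset.sum_image ShuffleWord.liftRight_injective.injOn, h', wordSumLeft, wordSumRight,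
    Finset.mul_sum, Finset.mul_sum, Finset.mul_sum]
  · simp only [wordWeight_consRight, wordWeight_liftRight, ite_mul]
    rw [Finset.sum_ite]
  · simp only [Finset.disjoint_left, Finset.mem_image, not_exists, not_and]
    rintro _ ⟨v, -, rfl⟩ w - hw
    exact w.zero_notMem_liftRight (hw ▸ List.mem_cons_self)

lemma wordSum_eq (m n : ℕ) :
    wordSum q t m n = wordSumLeft q t m n + wordSumRight q t m n + (1 + t) ^ m * q ^ n := by
  classical
  rw [wordSum, wordSumLeft, wordSumRight,
    ← Finset.sum_filter_add_sum_filter_not _ (fun u : ShuffleWord m n => startsLeft u.word),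
    add_assoc]
  congr 1
  have h : Finset.univ.filter (fun u : ShuffleWord m n => ¬ startsLeft u.word) =
      insert ⟨[], List.Pairwise.nil⟩
        (Finset.univ.filter fun u : ShuffleWord m n => startsRight u.word) := by
    ext ⟨_ | ⟨i | j, l⟩, h⟩ <;> rw [Finset.mem_insert, Finset.mem_filter, Finset.mem_filter] <;>
      simp [startsLeft, startsRight]
  rw [h, Finset.sum_insert (by rw [Finset.mem_filter]; simp [startsRight]), add_comm]
  congr 1
  -- The empty word, the only one starting in neither alphabet, has weight `(1 + t)^m * q^n`.
  simp [wordWeight, descents, mul_comm]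

/-- Eliminates `wordSumRight` and the empty word; `wordSum_succ_succ` then eliminates `wordSumLeft`
using `wordSumLeft_succ`. -/
lemma wordSum_succ_right (m n : ℕ) : wordSum q t m (n + 1) =
    (q + 1 + t) * wordSum q t m n + wordSumLeft q t m (n + 1) - t * wordSumLeft q t m n := by
  linear_combination wordSum_eq q t m (n + 1) + wordSumRight_succ q t m n - q * wordSum_eq q t m n

lemma wordSum_succ_succ (m n : ℕ) : wordSum q t (m + 1) (n + 1) =
    (q + 1 + t) * wordSum q t m (n + 1) + (q + 1 + t) * wordSum q t (m + 1) n +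
      (q * (q + 1) - (q + 1 + t) ^ 2) * wordSum q t m n := by
  linear_combination wordSum_succ_right q t (m + 1) n + wordSumLeft_succ q t m (n + 1) -
    t * wordSumLeft_succ q t m n - (1 + t) * wordSum_succ_right q t m n

lemma wordSum_succ_zero (m : ℕ) : wordSum q t (m + 1) 0 = (q + 1 + t) * wordSum q t m 0 := by
  linear_combination wordSum_eq q t (m + 1) 0 + wordSumLeft_succ q t m 0 -
    (1 + t) * wordSum_eq q t m 0 + wordSumRight_zero q t (m + 1) - (1 + t) * wordSumRight_zero q t m

lemma wordSum_zero_succ (n : ℕ) : wordSum q t 0 (n + 1) = (q + 1 + t) * wordSum q t 0 n := by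
  rw [wordSum_succ_right, wordSumLeft_zero, wordSumLeft_zero]
  ring

lemma wordSum_zero_zero : wordSum q t 0 0 = 1 := by
  rw [wordSum_eq, wordSumLeft_zero, wordSumRight_zero]
  simp

lemma wordSum_eq_faceSum (m n : ℕ) : wordSum q t m n = faceSum q t m n := by
  induction m generalizing n with
  | zero =>
    induction n with
    | zero => rw [wordSum_zero_zero, faceSum_zero_zero]
    | succ n ih => rw [wordSum_zero_succ, faceSum_zero_succ, ih]
  | succ m ihm =>
    induction n with
    | zero => rw [wordSum_succ_zero, faceSum_succ_zero, ihm]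
    | succ n ih => rw [wordSum_succ_succ, faceSum_succ_succ, ihm, ihm, ih]

end WordSum

/-! ### Change of variables in the `H`-triangle -/

lemma qVar_ne_zero : qVar ≠ 0 := by
  rw [qVar, Ne, FaithfulSMul.algebraMap_eq_zero_iff]
  exact MvPolynomial.X_ne_zero 0

lemma qVar_add_one_ne_zero : qVar + 1 ≠ 0 := by
  rw [qVar, ← map_one (algebraMap (MvPolynomial (Fin 2) ℤ) RationalFunctions), ← map_add, Ne,
    FaithfulSMul.algebraMap_eq_zero_iff]
  intro h
  simpa using congrArg (MvPolynomial.eval 0) h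

lemma wordWeight_eq {K : Type*} [Field K] {q t : K} (hq : q ≠ 0) (hq1 : q + 1 ≠ 0) {m n : ℕ}
    (u : ShuffleWord m n) :
    wordWeight q t u =
      q ^ (m + n) * (((q + 1) / q) ^ inDegree u * ((t + 1) / (q + 1)) ^ indelDegree u) := by
  have h1 := indelDegree_add u
  have h2 := countP_isLeft_le u
  have h3 := countP_isRight_le u
  have h4 := descents_le_countP u.word
  -- The exponent of `q` left after cancelling the denominators is `m + n` minus the in-degree.
  have e1 : m + n = u.word.countP (·.isLeft) + (n - u.word.countP (·.isRight)) +
      (indelDegree u + descents u.word) := by omega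
  have e2 : indelDegree u = (m - u.word.countP (·.isLeft)) +
      (u.word.countP (·.isRight) - descents u.word) := by omega
  have e3 : wordWeight q t u = q ^ (u.word.countP (·.isLeft) + (n - u.word.countP (·.isRight))) *
      (q + 1) ^ descents u.word * (1 + t) ^ indelDegree u := by
    rw [wordWeight, e2, pow_add, pow_add]
    ring
  rw [e3, inDegree_eq, e1, div_pow, div_pow, pow_add q _ (indelDegree u + descents u.word),
    pow_add (q + 1), add_comm 1 t]
  field_simp

lemma evalAt_HTriangle (m n : ℕ) :
    qVar ^ (m + n) * evalAt (HTriangle m n) ((qVar + 1) / qVar) ((tVar + 1) / (qVar + 1)) =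
      wordSum qVar tVar m n := by
  rw [evalAt, HTriangle, map_sum, Finset.mul_sum, wordSum]
  refine Finset.sum_congr rfl fun u _ => ?_
  rw [wordWeight_eq qVar_ne_zero qVar_add_one_ne_zero]
  simp

end BubbleLattice

open BubbleLattice
theorem theorem1p1 (m n : ℕ) :
    evalAt (FTriangle m n) qVar tVar =
      qVar ^ (m + n) *
        evalAt (HTriangle m n) ((qVar + 1) / qVar) ((tVar + 1) / (qVar + 1)) := by
  rw [evalAt_FTriangle, evalAt_HTriangle, wordSum_eq_faceSum]
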